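/- **Setting.** Let $T\in\mathbb N$ be a time horizon, $\mathcal E=\{0,1,\dots,B\}$ the set of energy levels, and $\mathcal X\subseteq\mathbb Z$ the state space (for example a finite interval). The source evolves as $X_{t+1}=X_t+Z_t$, where the $Z_t$ are independent and $Z_t$ has a distribution $\mu_t$ on $\mathbb Z$ of finite support that is even and almost symmetric unimodal about $0$. Here $f:\mathbb Z\to\mathbb R$ is *almost symmetric unimodal (a.s.u.) about* $a\in\mathbb Z$ if $f(a+n)\ge f(a-n)\ge f(a+n+1)$ for all $n=0,1,2,\dots$. The energy $e'$ left after the transmission decision at time $t$ changes, independently of the source, to $e$ at time $t+1$ with probability $\kappa_t(e\mid e')$, where $\kappa_t$ is any stochastic kernel on $\mathcal E$ (for example harvesting, $E_{t+1}=\min(E'_t+N_t,B)$). A transmission costs $c\in\mathbb R$ and uses one unit of energy. The distortion is $\rho(x,a)=d(|x-a|)$ for $x,a\in\mathcal X$ with $d$ real-valued and non-decreasing. Let $\mathcal X_t$ be the set of $x\in\mathbb Z$ such that a source in state $x$ at time $t$ stays in $\mathcal X$ at all times $t,\dots,T$ with probability one (so $\mathcal X_t=\mathbb Z$ if $\mathcal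 X=\mathbb Z$). A *belief at time* $t$ is a probability distribution of finite support on $\mathcal X_t\times\mathcal E$. A *prescription* is a function $\gamma:\mathbb Z\times\mathcal E\to[0,1]$ with $\gamma(x,0)=0$ for all $x$; $\gamma(x,e)$ is the probability of transmitting. **Value functions.** Put $W_{T+1}(\pi)=0$ and, for $t=T,T-1,\dots,1$, $$V_t(\theta)=W_{t+1}\big(Q^1_{t+1}(\theta)\big)+\inf_{a\in\mathcal X}\sum_{x,e}\rho(x,a)\,\theta(x,e),$$ $$W_t(\pi)=\inf_{\gamma}\ \sum_{x,e}\pi(x,e)\Big[\gamma(x,e)\big(c+V_t(\delta_{(x,e-1)})\big)+(1-\gamma(x,e))\,V_t(\theta^{\pi,\gamma})\Big],$$ the second infimum being over all prescriptions, where $$Q^1_{t+1}(\theta)(x,e)=\sum_{x'\in\mathbb Z,\,e'\in\mathcal E}\mu_t(x-x')\,\kappa_t(e\mid e')\,\theta(x',e'),\qquad \theta^{\pi,\gamma}(x,e)=\frac{\pi(x,e)(1-\gamma(x,e))}{\sum_{x',e'}\pi(x',e')(1-\gamma(x',e'))},$$ and $\delta_{(x,e-1)}$ is the point mass (terms of weight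 zero are zero). **Relation $\mathcal R$.** For summable non-negative $f,g$ on $\mathbb Z$ write $f\prec g$ if for every $n$ the sum of the $n$ largest values of $f$ is at most that of $g$, and $\sum_x f(x)=\sum_x g(x)$. For beliefs, $\theta\,\mathcal R\,\tilde\theta$ means that $\theta(\cdot,e)\prec\tilde\theta(\cdot,e)$ for every $e\in\mathcal E$ and that there is one point $b\in\mathbb Z$ such that $\tilde\theta(\cdot,e)$ is a.s.u. about $b$ for every $e\in\mathcal E$. **Claim.** The value functions have Property $\mathcal R$: for every $t\in\{1,\dots,T\}$ and all beliefs $\theta,\tilde\theta$ at time $t$ with $\theta\,\mathcal R\,\tilde\theta$ one has $V_t(\tilde\theta)\le V_t(\theta)$; and for every $t\in\{1,\dots,T+1\}$ and all beliefs $\pi,\tilde\pi$ at time $t$ with $\pi\,\mathcal R\,\tilde\pi$ one has $W_t(\tilde\pi)\le W_t(\pi)$. -/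

import Mathlib

namespace RemoteEstimation

/-- A mass function on pairs (source state, energy level); the energy levels are `0, …, B`. -/
abbrev Belief (B : ℕ) := ℤ → Fin (B + 1) → ℝ

/-- A probability distribution of finite support on `ℤ`. -/
def IsFinDist (p : ℤ → ℝ) : Prop :=
  (∀ x, 0 ≤ p x) ∧ (Function.support p).Finite ∧ ∑' x, p x = 1

/-- A probability distribution of finite support on `ℤ × {0, …, B}`. -/
def IsBelief {B : ℕ} (θ : Belief B) : Prop :=
  (∀ x e, 0 ≤ θ x e) ∧ (∀ e, (Function.support fun x => θ x e).Finite) ∧ ∑' x, ∑ e, θ x e = 1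

/-- Almost symmetric and unimodal (a.s.u.) about `a`:
`f a ≥ f (a + 1) ≥ f (a - 1) ≥ f (a + 2) ≥ f (a - 2) ≥ ⋯`. -/
def IsASU (a : ℤ) (f : ℤ → ℝ) : Prop :=
  ∀ n : ℕ, f (a - n) ≤ f (a + n) ∧ f (a + n + 1) ≤ f (a - n)

/-- The sum of the `n` largest values of a function on `ℤ`. -/
noncomputable def topSum (f : ℤ → ℝ) (n : ℕ) : ℝ :=
  ⨆ A : {A : Finset ℤ // A.card = n}, ∑ x ∈ A.1, f x

/-- Majorization `f ≺ g`. -/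
def Majorized (f g : ℤ → ℝ) : Prop :=
  (∀ n, topSum f n ≤ topSum g n) ∧ ∑' x, f x = ∑' x, g x

/-- The relation `θ R θ'`. -/
def RelR {B : ℕ} (θ θ' : Belief B) : Prop :=
  (∀ e, Majorized (fun x => θ x e) (fun x => θ' x e)) ∧
    ∃ b : ℤ, ∀ e, IsASU b (fun x => θ' x e)

/-- The data of the problem. -/
structure Model (B : ℕ) where
  /-- the time horizon -/
  T : ℕ
  /-- the state space, which is also the set of possible estimates -/
  X : Set ℤ
  /-- `noise t` is the distribution of `Z_t`, where `X_{t+1} = X_t + Z_t` -/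
  noise : ℕ → ℤ → ℝ
  /-- `energy t e' e` is the probability that `E_{t+1} = e` given that the energy that is left after
  the transmission decision at time `t` is `e'` -/
  energy : ℕ → Fin (B + 1) → PMF (Fin (B + 1))
  /-- the cost of a transmission -/
  c : ℝ
  /-- the distortion -/
  ρ : ℤ → ℤ → ℝ

/-- Prescriptions: `γ x e` is the probability of transmitting in state `x` with energy `e`;
no transmission is possible without energy. -/
def Prescription (B : ℕ) : Type :=
  {γ : ℤ → Fin (B + 1) → ℝ // (∀ x e, 0 ≤ γ x e ∧ γ x e ≤ 1) ∧ ∀ x, γ x 0 = 0}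

/-- The energy that is left after a transmission. -/
def spend {B : ℕ} (e : Fin (B + 1)) : Fin (B + 1) :=
  ⟨(e : ℕ) - 1, lt_of_le_of_lt (Nat.sub_le _ _) e.isLt⟩

/-- The point mass at `(x, e)`. -/
noncomputable def pointMass {B : ℕ} (x : ℤ) (e : Fin (B + 1)) : Belief B :=
  fun x' e' => if x' = x ∧ e' = e then 1 else 0

/-- The belief update after the transmission decision. The observation is `some (x, e)` if
`(X_t, E_t) = (x, e)` was transmitted and `none` if nothing was transmitted. -/
noncomputable def Q2 {B : ℕ} (π : Belief B) (γ : Prescription B) :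
    Option (ℤ × Fin (B + 1)) → Belief B
  | some (x, e) => pointMass x (spend e)
  | none => fun x e =>
      π x e * (1 - γ.1 x e) / ∑' x', ∑ e', π x' e' * (1 - γ.1 x' e')

namespace Model

variable {B : ℕ} (M : Model B)

/-- The belief update `Q¹_{t+1}` from the end of step `t` to the beginning of step `t + 1`. -/
noncomputable def Q1 (t : ℕ) (θ : Belief B) : Belief B := fun x e =>
  ∑' x', ∑ e', M.noise t (x - x') * (M.energy t e' e).toReal * θ x' e'

/-- One step of the recursion: the function `V_t` obtained from `W = W_{t+1}`. -/
noncomputable def stepV (t : ℕ) (W : Belief B → ℝ) (θ : Belief B) : ℝ :=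
  W (M.Q1 t θ) + ⨅ a : M.X, ∑' x, ∑ e, M.ρ x a * θ x e

/-- The expectation of `c 1_{U_t = 1} + V (Θ_t)` given `Π_t = π` and the prescription `γ`. -/
noncomputable def costW (V : Belief B → ℝ) (π : Belief B) (γ : Prescription B) : ℝ :=
  ∑' x, ∑ e, π x e *
    (γ.1 x e * (M.c + V (Q2 π γ (some (x, e)))) + (1 - γ.1 x e) * V (Q2 π γ none))

/-- One step of the recursion: the function `W_t` obtained from `V = V_t`. -/
noncomputable def stepW (V : Belief B → ℝ) (π : Belief B) : ℝ :=
  ⨅ γ : Prescription B, M.costW V π γ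

/-- `M.valueW k` is the function `W_t` for `t = T + 1 - k`. -/
noncomputable def valueW : ℕ → Belief B → ℝ
  | 0 => fun _ => 0
  | k + 1 => M.stepW (M.stepV (M.T - k) (valueW k))

/-- The value function `W_t`, for `t = 1, …, T + 1`. -/
noncomputable def W (t : ℕ) : Belief B → ℝ := M.valueW (M.T + 1 - t)

/-- The value function `V_t`, for `t = 1, …, T`. -/
noncomputable def V (t : ℕ) : Belief B → ℝ := M.stepV t (M.W (t + 1))

theorem W_terminal : M.W (M.T + 1) = fun _ => 0 := by
  simp [W, valueW]

theorem V_eq (t : ℕ) (θ : Belief B) :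
    M.V t θ = M.W (t + 1) (M.Q1 t θ) + ⨅ a : M.X, ∑' x, ∑ e, M.ρ x a * θ x e := rfl

theorem W_eq {t : ℕ} (ht : t ≤ M.T) (π : Belief B) :
    M.W t π = ⨅ γ : Prescription B, M.costW (M.V t) π γ := by
  have h1 : M.T + 1 - t = (M.T - t) + 1 := by omega
  have h2 : M.T - (M.T - t) = t := by omega
  have h3 : M.T + 1 - (t + 1) = M.T - t := by omega
  unfold W V W
  rw [h1, h3, valueW, h2]
  rfl

/-- `M.Reach t x s y`: the source can be in state `y` at time `s` if it is in state `x` at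
time `t`. -/
inductive Reach (t : ℕ) (x : ℤ) : ℕ → ℤ → Prop
  | refl : Reach t x t x
  | step {s : ℕ} {y z : ℤ} : Reach t x s y → 0 < M.noise s z → Reach t x (s + 1) (y + z)

/-- The possible states at time `t`: those from which the source stays in the state space up to
the horizon. It is all of `ℤ` if the state space is `ℤ`. -/
def states (t : ℕ) : Set ℤ := {x | ∀ s ≤ M.T, ∀ y, M.Reach t x s y → y ∈ M.X}

/-- The beliefs at time `t`: the probability distributions of finite support on
`states t × {0, …, B}`. -/
def BeliefAt (t : ℕ) (θ : Belief B) : Prop :=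
  IsBelief θ ∧ ∀ x e, θ x e ≠ 0 → x ∈ M.states t

/-- `F` satisfies Property R, as a function of the beliefs at time `t`. -/
def PropertyR (t : ℕ) (F : Belief B → ℝ) : Prop :=
  ∀ θ θ' : Belief B, M.BeliefAt t θ → M.BeliefAt t θ' → RelR θ θ' → F θ' ≤ F θ

end Model

end RemoteEstimation

namespace RemoteEstimation

/-! Property R propagates backwards in time through both half-steps of the recursion. Against an
a.s.u. `g`, majorization becomes `Dominated`: a finite sum of `f` never exceeds the sum of `g` over
the equally large block about `b`. Blocks do not depend on the energy level, so domination survives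
sums over levels with nonnegative weights; hence the common center in `RelR`. For `stepV`, Riesz's
inequality for intervals of integers, combined with the Hardy–Littlewood inequality
`Dominated.tsum_mul_le`, shows that the source noise preserves R (`relR_Q1`). Hardy–Littlewood
applied to minus the distortion shows that estimating `b` under the better belief costs no more than
any estimate under the other. For `stepW`, any two point masses at the same energy level are related
both ways, so the value after a transmission depends on the energy alone. A prescription then
matters only through the silent mass of each level and the belief after silence. Given `γ` for `π`,
a matching prescription for `π'` keeps silent, at each level, the same mass packed around `b`: the
transmission terms agree and the silent beliefs are again related by R. -/

open Finset

/-! ### Enumeration of the integers by distance to a point -/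

/-- The enumeration `b, b + 1, b - 1, b + 2, b - 2, …` of the integers. -/
def zig (b : ℤ) : ℕ ≃ ℤ where
  toFun n := if n % 2 = 0 then b - (n / 2 : ℕ) else b + ((n + 1) / 2 : ℕ)
  invFun x := if x ≤ b then 2 * (b - x).toNat else 2 * (x - b).toNat - 1
  left_inv n := by
    dsimp only
    split_ifs <;> omega
  right_inv x := by
    dsimp only
    split_ifs <;> omega

theorem zig_even (b : ℤ) (n : ℕ) : zig b (2 * n) = b - n := by
  simp only [zig, Equiv.coe_fn_mk]
  split_ifs <;> omega

theorem zig_odd (b : ℤ) (n : ℕ) : zig b (2 * n + 1) = b + n + 1 := by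
  simp only [zig, Equiv.coe_fn_mk]
  split_ifs <;> omega

theorem isASU_iff_antitone {b : ℤ} {f : ℤ → ℝ} :
    IsASU b f ↔ Antitone fun n => f (zig b n) := by
  constructor
  · intro h
    refine antitone_nat_of_succ_le fun n => ?_
    obtain ⟨k, rfl | rfl⟩ := Nat.even_or_odd' n
    · rw [zig_even, zig_odd]
      exact (h k).2
    · rw [zig_odd, show 2 * k + 1 + 1 = 2 * (k + 1) by ring, zig_even]
      have := (h (k + 1)).1
      push_cast at this ⊢
      rwa [add_assoc]
  · intro h n
    constructor
    · rcases n with _ | n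
      · simp
      · have := h (show 2 * n + 1 ≤ 2 * (n + 1) by omega)
        simp only [zig_odd, zig_even] at this
        push_cast at this ⊢
        rwa [← add_assoc]
    · have := h (show 2 * n ≤ 2 * n + 1 by omega)
      simpa only [zig_odd, zig_even] using this

/-- The `n` integers closest to `b`, with ties broken to the right. -/
def block (b : ℤ) (n : ℕ) : Finset ℤ := (range n).map (zig b).toEmbedding

@[simp] theorem card_block (b : ℤ) (n : ℕ) : (block b n).card = n := by simp [block]

theorem sum_block (b : ℤ) (n : ℕ) (f : ℤ → ℝ) :
    ∑ x ∈ block b n, f x = ∑ i ∈ range n, f (zig b i) := by simp [block]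

theorem mem_block {b x : ℤ} {n : ℕ} :
    x ∈ block b n ↔ 2 * b < 2 * x + n ∧ 2 * x ≤ 2 * b + n := by
  have h : x ∈ block b n ↔ (zig b).symm x < n := by
    simp only [block, mem_map, mem_range, Equiv.coe_toEmbedding]
    constructor
    · rintro ⟨i, hi, rfl⟩
      simpa using hi
    · exact fun hx => ⟨_, hx, by simp⟩
  rw [h]
  simp only [zig, Equiv.coe_fn_symm_mk]
  split_ifs <;> omega

theorem block_eq_Ico (b : ℤ) (n : ℕ) :
    block b n = Ico (b - (n - 1 : ℤ) / 2) (b - (n - 1 : ℤ) / 2 + n) := by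
  ext x
  rw [mem_block, mem_Ico]
  omega

/-! ### Sums over finite sets -/

/-- Exchange argument: after the common part is cancelled, the least value on `I \ S` separates two
sets of equal size. -/
theorem sum_le_sum_of_card_eq {ι : Type*} [DecidableEq ι] {f : ι → ℝ} {S I : Finset ι}
    (hcard : S.card = I.card) (h : ∀ x ∈ I, ∀ y ∉ I, f y ≤ f x) :
    ∑ x ∈ S, f x ≤ ∑ x ∈ I, f x := by
  rw [← sum_sdiff_le_sum_sdiff]
  have hc : (S \ I).card = (I \ S).card := card_sdiff_comm hcard
  rcases (I \ S).eq_empty_or_nonempty with hI | hI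
  · rw [hI, card_empty, card_eq_zero] at hc
    rw [hI, hc]
  · obtain ⟨z, hz, hmin⟩ := exists_min_image (I \ S) f hI
    calc ∑ x ∈ S \ I, f x ≤ (S \ I).card • f z :=
          sum_le_card_nsmul _ _ _ fun y hy => h z (mem_sdiff.1 hz).1 y (mem_sdiff.1 hy).2
      _ = (I \ S).card • f z := by rw [hc]
      _ ≤ ∑ x ∈ I \ S, f x := card_nsmul_le_sum _ _ _ hmin

theorem IsASU.sum_le_sum_block {b : ℤ} {f : ℤ → ℝ} (h : IsASU b f) (A : Finset ℤ) :
    ∑ x ∈ A, f x ≤ ∑ x ∈ block b A.card, f x := by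
  rw [isASU_iff_antitone] at h
  refine sum_le_sum_of_card_eq (by simp) fun x hx y hy => ?_
  obtain ⟨i, rfl⟩ := (zig b).surjective x
  obtain ⟨j, rfl⟩ := (zig b).surjective y
  simp only [block, mem_map_equiv, Equiv.symm_apply_apply, mem_range] at hx hy
  exact h (by omega)

theorem IsASU.le_center {b : ℤ} {f : ℤ → ℝ} (h : IsASU b f) (x : ℤ) : f x ≤ f b := by
  have := h.sum_le_sum_block {x}
  simpa [sum_block, show zig b 0 = b by simpa using zig_even b 0] using this

/-- `f` is dominated by `g`: the sum of `f` over a finite set is at most the sum of `g` over the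
block of the same size about `b`. -/
def Dominated (b : ℤ) (f g : ℤ → ℝ) : Prop :=
  ∀ A : Finset ℤ, ∑ x ∈ A, f x ≤ ∑ x ∈ block b A.card, g x

theorem bddAbove_topSum {f : ℤ → ℝ} (h0 : ∀ x, 0 ≤ f x) (hf : f.support.Finite) (n : ℕ) :
    BddAbove (Set.range fun A : {A : Finset ℤ // A.card = n} => ∑ x ∈ A.1, f x) := by
  refine ⟨∑' x, f x, ?_⟩
  rintro _ ⟨A, rfl⟩
  exact (summable_of_hasFiniteSupport hf).sum_le_tsum _ fun x _ => h0 x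

theorem sum_le_topSum {f : ℤ → ℝ} (h0 : ∀ x, 0 ≤ f x) (hf : f.support.Finite) (A : Finset ℤ) :
    ∑ x ∈ A, f x ≤ topSum f A.card :=
  le_ciSup (bddAbove_topSum h0 hf A.card) ⟨A, rfl⟩

theorem Majorized.dominated {b : ℤ} {f g : ℤ → ℝ} (h : Majorized f g) (h0 : ∀ x, 0 ≤ f x)
    (hf : f.support.Finite) (hg : IsASU b g) : Dominated b f g := by
  intro A
  refine (sum_le_topSum h0 hf A).trans ((h.1 A.card).trans ?_)
  have : Nonempty {C : Finset ℤ // C.card = A.card} := ⟨⟨A, rfl⟩⟩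
  refine ciSup_le fun C => ?_
  have := hg.sum_le_sum_block C.1
  rwa [C.2] at this

theorem Dominated.majorized {b : ℤ} {f g : ℤ → ℝ} (h : Dominated b f g) (h0 : ∀ x, 0 ≤ g x)
    (hg : g.support.Finite) (hfg : ∑' x, f x = ∑' x, g x) : Majorized f g := by
  refine ⟨fun n => ?_, hfg⟩
  have : Nonempty {C : Finset ℤ // C.card = n} := ⟨⟨block 0 n, by simp⟩⟩
  refine ciSup_le fun C => ?_
  have h1 := sum_le_topSum h0 hg (block b C.1.card)
  rw [card_block] at h1
  have := (h C.1).trans h1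
  rwa [C.2] at this

/-! ### Rearrangement -/

theorem exists_forall_ge_eq_zero {f : ℤ → ℝ} (hf : f.support.Finite) (σ : ℕ ≃ ℤ) :
    ∃ N, ∀ i, N ≤ i → f (σ i) = 0 := by
  obtain ⟨N, hN⟩ := (hf.preimage (f := σ) σ.injective.injOn).bddAbove
  refine ⟨N + 1, fun i hi => ?_⟩
  by_contra h
  have : i ≤ N := hN (show σ i ∈ f.support from h)
  omega

theorem exists_antitone_enum {f : ℤ → ℝ} (h0 : ∀ x, 0 ≤ f x) (hf : f.support.Finite) :
    ∃ σ : ℕ ≃ ℤ, Antitone fun n => f (σ n) := by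
  obtain ⟨N, hN⟩ := exists_forall_ge_eq_zero hf (zig 0)
  -- Beyond `N` there are only zeros, which already come last because `f ≥ 0`; only the first `N`
  -- values need sorting, negated to make the order decreasing.
  set s := Tuple.sort fun i : Fin N => -f (zig 0 i) with hs
  let τ : Equiv.Perm ℕ := s.extendDomain (Fin.equivSubtype (n := N))
  have h1 : ∀ i (hi : i < N), τ i = s ⟨i, hi⟩ := fun i hi => by
    simpa using Equiv.Perm.extendDomain_apply_subtype s (Fin.equivSubtype (n := N)) hi
  have h2 : ∀ i, ¬ i < N → τ i = i := fun i hi =>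
    Equiv.Perm.extendDomain_apply_not_subtype s (Fin.equivSubtype (n := N)) hi
  refine ⟨τ.trans (zig 0), fun i j hij => ?_⟩
  simp only [Equiv.trans_apply]
  by_cases hj : j < N
  · have := Tuple.monotone_sort (fun i : Fin N => -f (zig 0 i))
      (show (⟨i, by omega⟩ : Fin N) ≤ ⟨j, hj⟩ from hij)
    simp only [Function.comp_apply, ← hs] at this
    rw [h1 i (by omega), h1 j hj]
    linarith
  · rw [h2 j hj, hN j (by omega)]
    exact h0 _

/-- Abel summation in inequality form. `φ` may change sign, so the boundary term on the left has to
stay. -/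
theorem mul_sum_le_sum_mul {φ u : ℕ → ℝ} (hφ : Antitone φ) (hu : ∀ n, 0 ≤ ∑ i ∈ range n, u i)
    (n : ℕ) : φ n * ∑ i ∈ range n, u i ≤ ∑ i ∈ range n, φ i * u i := by
  induction n with
  | zero => simp
  | succ n ih =>
    have h1 := mul_le_mul_of_nonneg_right (hφ n.le_succ) (hu (n + 1))
    refine h1.trans ?_
    rw [sum_range_succ, sum_range_succ, mul_add]
    linarith

theorem tsum_eq_sum_range {f : ℤ → ℝ} (σ : ℕ ≃ ℤ) {N : ℕ} (hN : ∀ i, N ≤ i → f (σ i) = 0) :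
    ∑' x, f x = ∑ i ∈ range N, f (σ i) := by
  rw [← σ.tsum_eq]
  exact tsum_eq_sum fun i hi => hN i (by simpa using hi)

/-- Hardy–Littlewood in two exchanges: with `f` listed in decreasing order by `σ`, first `h` along
`σ` is replaced by `h'` along `zig b`, then `f` along `σ` by `g` along `zig b`. -/
theorem Dominated.tsum_mul_le {b : ℤ} {f g h h' : ℤ → ℝ} (hfg : Dominated b f g)
    (hf0 : ∀ x, 0 ≤ f x) (hf : f.support.Finite) (hg : g.support.Finite)
    (htot : ∑' x, f x = ∑' x, g x) (hh : Dominated b h h') (hh' : IsASU b h') :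
    ∑' x, f x * h x ≤ ∑' x, g x * h' x := by
  obtain ⟨σ, hσ⟩ := exists_antitone_enum hf0 hf
  obtain ⟨N₁, hN₁⟩ := exists_forall_ge_eq_zero hf σ
  obtain ⟨N₂, hN₂⟩ := exists_forall_ge_eq_zero hg (zig b)
  set N := max N₁ N₂
  have hfN : ∀ i, N ≤ i → f (σ i) = 0 := fun i hi => hN₁ i ((le_max_left _ _).trans hi)
  have hgN : ∀ i, N ≤ i → g (zig b i) = 0 := fun i hi => hN₂ i ((le_max_right _ _).trans hi)
  have key : ∀ {p q : ℤ → ℝ}, Dominated b p q → ∀ n,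
      0 ≤ ∑ i ∈ range n, (q (zig b i) - p (σ i)) := fun {p q} hpq n => by
    have := hpq ((range n).map σ.toEmbedding)
    simp only [card_map, card_range, sum_map, sum_block, Equiv.coe_toEmbedding] at this
    rw [sum_sub_distrib]
    linarith
  have h1 := mul_sum_le_sum_mul hσ (key hh) N
  have h2 := mul_sum_le_sum_mul (isASU_iff_antitone.1 hh') (key hfg) N
  rw [tsum_eq_sum_range σ hfN, tsum_eq_sum_range (zig b) hgN] at htot
  rw [tsum_eq_sum_range σ fun i hi => by rw [hfN i hi, zero_mul],
    tsum_eq_sum_range (zig b) fun i hi => by rw [hgN i hi, zero_mul]]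
  -- The Abel boundary terms vanish: here because `f` is zero from `N` on, in `h2` because the total
  -- masses agree.
  rw [hfN N le_rfl, zero_mul] at h1
  rw [sum_sub_distrib, htot, sub_self, mul_zero] at h2
  simp only [mul_comm (h' _), mul_sub, sub_mul, sum_sub_distrib] at h1 h2
  linarith

/-! ### Convolution with an even unimodal kernel -/

theorem IsASU.le_of_abs_le {μ : ℤ → ℝ} (hμ : IsASU 0 μ) (heven : ∀ z, μ (-z) = μ z) {x y : ℤ}
    (h : |x| ≤ |y|) : μ y ≤ μ x := by
  have habs : ∀ z, μ z = μ z.natAbs := fun z => by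
    rcases Int.natAbs_eq z with h | h
    · rw [← h]
    · conv_lhs => rw [h, heven]
  have hanti : Antitone fun n : ℕ => μ n := antitone_nat_of_succ_le fun n => by
    have := (hμ n).2
    rw [zero_add, zero_sub, heven] at this
    exact_mod_cast this
  rw [habs x, habs y]
  exact hanti (by zify; exact h)

/-- The hypothesis places the midpoint of the interval within 1/2 of 0, so no integer outside it is
closer to 0 than one inside. -/
theorem sum_le_sum_Ico {μ : ℤ → ℝ} (hμ : IsASU 0 μ) (heven : ∀ z, μ (-z) = μ z) {p : ℤ}
    {S : Finset ℤ} (h : |2 * p + S.card - 1| ≤ 1) :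
    ∑ x ∈ S, μ x ≤ ∑ x ∈ Ico p (p + S.card), μ x := by
  refine sum_le_sum_of_card_eq (by simp) fun x hx y hy => hμ.le_of_abs_le heven ?_
  rw [mem_Ico] at hx hy
  rw [abs_le] at h
  rcases abs_cases x with hx' | hx' <;> rcases abs_cases y with hy' | hy' <;> omega

/-- Peel off the pairs that involve a maximum. The differences `j - x` are at most `y - x` and the
remaining `y - i` exceed it, so all of them are distinct. -/
theorem sum_sum_eq_erase_add {μ : ℤ → ℝ} {C A : Finset ℤ} {x y : ℤ} (hx : x ∈ C) (hy : y ∈ A)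
    (hC : ∀ i ∈ C, i ≤ x) (hA : ∀ j ∈ A, j ≤ y) :
    ∑ i ∈ C, ∑ j ∈ A, μ (j - i) = ∑ i ∈ C.erase x, ∑ j ∈ A.erase y, μ (j - i) +
        ∑ z ∈ A.image (fun j => j - x) ∪ (C.erase x).image (fun i => y - i), μ z ∧
      (A.image (fun j => j - x) ∪ (C.erase x).image (fun i => y - i)).card =
        A.card + (C.erase x).card := by
  have hdisj : Disjoint (A.image (fun j => j - x)) ((C.erase x).image (fun i => y - i)) := by
    rw [disjoint_left]
    simp only [mem_image, mem_erase]
    rintro _ ⟨j, hj, rfl⟩ ⟨i, ⟨hne, hi⟩, hij⟩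
    have := hA j hj
    have := hC i hi
    omega
  have i1 : Function.Injective fun j : ℤ => j - x := fun a b h => by simpa using h
  have i2 : Function.Injective fun i : ℤ => y - i := fun a b h => by simpa using h
  refine ⟨?_, by rw [card_union_of_disjoint hdisj, card_image_of_injective _ i1,
    card_image_of_injective _ i2]⟩
  rw [sum_union hdisj, sum_image i1.injOn, sum_image i2.injOn, ← add_sum_erase C _ hx]
  have : ∀ i ∈ C.erase x, ∑ j ∈ A, μ (j - i) = ∑ j ∈ A.erase y, μ (j - i) + μ (y - i) :=
    fun i _ => (sum_erase_add A _ hy).symm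
  rw [sum_congr rfl this, sum_add_distrib]
  ring

/-- Riesz's rearrangement inequality for finite sets of integers. -/
theorem sum_sum_le_sum_sum_Ico {μ : ℤ → ℝ} (hμ : IsASU 0 μ) (heven : ∀ z, μ (-z) = μ z) :
    ∀ (m n : ℕ) {C A : Finset ℤ} {p q : ℤ}, C.card = m → A.card = n →
      |(2 * p + m) - (2 * q + n)| ≤ 1 →
      ∑ i ∈ C, ∑ j ∈ A, μ (j - i) ≤ ∑ i ∈ Ico p (p + m), ∑ j ∈ Ico q (q + n), μ (j - i)
  | 0, n, C, A, p, q, hC, _, _ => by simp [card_eq_zero.1 hC]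
  | m + 1, 0, C, A, p, q, _, hA, _ => by simp [card_eq_zero.1 hA]
  | m + 1, n + 1, C, A, p, q, hC, hA, hpq => by
    have neC : C.Nonempty := card_pos.1 (by omega)
    have neA : A.Nonempty := card_pos.1 (by omega)
    obtain ⟨h1, h2⟩ := sum_sum_eq_erase_add (μ := μ) (C.max'_mem neC) (A.max'_mem neA)
      (fun i hi => C.le_max' i hi) fun j hj => A.le_max' j hj
    obtain ⟨h3, -⟩ := sum_sum_eq_erase_add (μ := μ) (C := Ico p (p + (m + 1 : ℕ)))
      (A := Ico q (q + (n + 1 : ℕ))) (x := p + m) (y := q + n)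
      (by rw [mem_Ico]; omega) (by rw [mem_Ico]; omega)
      (fun i hi => by rw [mem_Ico] at hi; omega) (fun i hi => by rw [mem_Ico] at hi; omega)
    have e1 : (Ico p (p + (m + 1 : ℕ))).erase (p + m) = Ico p (p + m) := by
      ext z; simp only [mem_erase, mem_Ico]; omega
    have e2 : (Ico q (q + (n + 1 : ℕ))).erase (q + n) = Ico q (q + n) := by
      ext z; simp only [mem_erase, mem_Ico]; omega
    -- For intervals the peeled differences fill an interval nearly centered at 0, the best case of
    -- `sum_le_sum_Ico`. Both intervals lose their right endpoint, so the distance of their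
    -- midpoints is unchanged for the induction.
    have e3 : (Ico q (q + (n + 1 : ℕ))).image (fun j => j - (p + m)) ∪
        (Ico p (p + m)).image (fun i => q + n - i) = Ico (q - p - m) (q - p - m + (n + 1 + m : ℕ)) := by
      ext z
      simp only [mem_union, mem_image, mem_Ico]
      constructor
      · rintro (⟨j, hj, rfl⟩ | ⟨i, hi, rfl⟩) <;> omega
      · intro hz
        by_cases h : z ≤ q + n - (p + m)
        · exact Or.inl ⟨z + (p + m), by omega, by omega⟩
        · exact Or.inr ⟨q + n - z, by omega, by omega⟩
    have hC' : (C.erase (C.max' neC)).card = m := by rw [card_erase_of_mem (C.max'_mem neC)]; omega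
    have hA' : (A.erase (A.max' neA)).card = n := by rw [card_erase_of_mem (A.max'_mem neA)]; omega
    rw [e1, e2, e3] at h3
    rw [hC', hA] at h2
    rw [h1, h3]
    refine add_le_add (sum_sum_le_sum_sum_Ico hμ heven m n hC' hA' ?_) ?_
    · convert hpq using 2
      push_cast
      ring
    · rw [← h2]
      refine sum_le_sum_Ico hμ heven ?_
      rw [h2]
      rw [abs_le] at hpq ⊢
      push_cast at hpq ⊢
      constructor <;> linarith

/-- Symmetrize under `y ↦ c - y`: twice the difference of the two sides is a sum of products whose
factors have equal sign on each side of `c / 2`. -/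
theorem tsum_conv_reflect_le {μ : ℤ → ℝ} (hμ : IsASU 0 μ) (heven : ∀ z, μ (-z) = μ z) {c : ℤ}
    {g : ℤ → ℝ} (hg : g.support.Finite) (h : ∀ y, c ≤ 2 * y → g (c - y) ≤ g y) {x : ℤ}
    (hx : c ≤ 2 * x) : ∑' y, μ (c - x - y) * g y ≤ ∑' y, μ (x - y) * g y := by
  have hs : ∀ u : ℤ → ℝ, Summable fun y => u y * g y := fun u =>
    summable_of_hasFiniteSupport (hg.subset (Function.support_mul_subset_right u g))
  have e : ∀ u : ℤ → ℝ, ∑' y, u y * g y = ∑' y, u (c - y) * g (c - y) := fun u =>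
    ((Equiv.subLeft c).tsum_eq fun y => u y * g y).symm
  have hs' : ∀ u : ℤ → ℝ, Summable fun y => u y * g (c - y) := fun u => by
    have := (Equiv.subLeft c).summable_iff.2 (hs fun y => u (c - y))
    simpa [Function.comp_def] using this
  have e1 := e fun y => μ (x - y)
  have e2 := e fun y => μ (c - x - y)
  have f1 : ∀ y, μ (x - (c - y)) = μ (c - x - y) := fun y => by rw [← heven]; congr 1; ring
  have f2 : ∀ y, μ (c - x - (c - y)) = μ (x - y) := fun y => by rw [← heven]; congr 1; ring
  simp only [f1, f2] at e1 e2
  have key : 0 ≤ ∑' y, (μ (x - y) - μ (c - x - y)) * (g y - g (c - y)) := by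
    refine tsum_nonneg fun y => ?_
    rcases le_total c (2 * y) with hy | hy
    · refine mul_nonneg (sub_nonneg.2 (hμ.le_of_abs_le heven ?_)) (sub_nonneg.2 (h y hy))
      rcases abs_cases (x - y) with hx' | hx' <;> rcases abs_cases (c - x - y) with hy' | hy' <;>
        omega
    · refine mul_nonneg_of_nonpos_of_nonpos (sub_nonpos.2 (hμ.le_of_abs_le heven ?_))
        (sub_nonpos.2 ?_)
      · rcases abs_cases (x - y) with hx' | hx' <;> rcases abs_cases (c - x - y) with hy' | hy' <;>
          omega
      · have := h (c - y) (by omega)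
        rwa [sub_sub_cancel] at this
  have expand : ∑' y, (μ (x - y) - μ (c - x - y)) * (g y - g (c - y)) =
      (∑' y, μ (x - y) * g y - ∑' y, μ (c - x - y) * g y) -
        (∑' y, μ (x - y) * g (c - y) - ∑' y, μ (c - x - y) * g (c - y)) := by
    rw [← (hs _).tsum_sub (hs _), ← (hs' _).tsum_sub (hs' _),
      ← ((hs _).sub (hs _)).tsum_sub ((hs' _).sub (hs' _))]
    exact tsum_congr fun y => by ring
  linarith

/-- Being a.s.u. about `b` amounts to two reflection inequalities, with `c = 2b` for `g` and `c = 2b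
+ 1` for `-g`; convolution preserves each. -/
theorem IsASU.conv {μ : ℤ → ℝ} (hμ : IsASU 0 μ) (heven : ∀ z, μ (-z) = μ z) {b : ℤ} {g : ℤ → ℝ}
    (hg : g.support.Finite) (h : IsASU b g) : IsASU b fun x => ∑' y, μ (x - y) * g y := by
  intro n
  constructor
  · have := tsum_conv_reflect_le hμ heven (c := 2 * b) (x := b + n) hg (fun y hy => by
      have := (h (y - b).toNat).1
      rw [show b - ((y - b).toNat : ℤ) = 2 * b - y by omega,
        show b + ((y - b).toNat : ℤ) = y by omega] at this
      exact this) (by omega)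
    rwa [show 2 * b - (b + n) = b - n by ring] at this
  · have := tsum_conv_reflect_le hμ heven (c := 2 * b + 1) (x := b + n + 1) (g := fun y => -g y)
      (by simpa using hg) (fun y hy => by
        have := (h (y - b - 1).toNat).2
        rw [show b - ((y - b - 1).toNat : ℤ) = 2 * b + 1 - y by omega,
          show b + ((y - b - 1).toNat : ℤ) + 1 = y by omega] at this
        linarith) (by omega)
    rw [show 2 * b + 1 - (b + n + 1) = b - n by ring] at this
    simp only [mul_neg, tsum_neg] at this
    linarith

theorem isASU_sum_block {μ : ℤ → ℝ} (hμ : IsASU 0 μ) (heven : ∀ z, μ (-z) = μ z) (b : ℤ) (n : ℕ) :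
    IsASU b fun x => ∑ y ∈ block b n, μ (y - x) := by
  have hfin : (fun y => if y ∈ block b n then (1 : ℝ) else 0).support.Finite :=
    (block b n).finite_toSet.subset fun y hy => by
      by_contra h
      exact hy (if_neg h)
  have h1 : IsASU b fun y => if y ∈ block b n then (1 : ℝ) else 0 := by
    intro k
    simp only [mem_block]
    constructor <;> split_ifs <;> first | omega | norm_num
  have := IsASU.conv hμ heven hfin h1
  convert this using 2 with x
  rw [tsum_eq_sum (s := block b n) fun y hy => by simp [hy]]
  exact sum_congr rfl fun y hy => by rw [if_pos hy, mul_one, ← heven, neg_sub]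

/-- Moving the sum over `A` onto the kernel leaves `f` paired with `y ↦ ∑ x ∈ A, μ (x - y)`. Riesz
dominates this weight by the one of the block, which is a.s.u., and Hardy–Littlewood applies. -/
theorem Dominated.conv {μ : ℤ → ℝ} (hμ : IsASU 0 μ) (heven : ∀ z, μ (-z) = μ z)
    {b : ℤ} {f g : ℤ → ℝ} (hfg : Dominated b f g)
    (hf0 : ∀ x, 0 ≤ f x) (hf : f.support.Finite) (hg : g.support.Finite)
    (htot : ∑' x, f x = ∑' x, g x) :
    Dominated b (fun x => ∑' y, μ (x - y) * f y) fun x => ∑' y, μ (x - y) * g y := by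
  intro A
  have hs : ∀ {k : ℤ → ℝ}, k.support.Finite → ∀ u : ℤ → ℝ, Summable fun y => u y * k y :=
    fun {k} hk u => summable_of_hasFiniteSupport (hk.subset (Function.support_mul_subset_right u k))
  rw [← Summable.tsum_finsetSum fun x _ => hs hf _, ← Summable.tsum_finsetSum fun x _ => hs hg _]
  simp only [← sum_mul]
  simp only [mul_comm _ (f _), mul_comm _ (g _)]
  refine hfg.tsum_mul_le hf0 hf hg htot (fun C => ?_) (isASU_sum_block hμ heven b _)
  rw [block_eq_Ico, block_eq_Ico]
  refine sum_sum_le_sum_sum_Ico hμ heven C.card A.card rfl rfl ?_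
  rw [abs_le]
  omega

/-! ### Retaining the mass closest to the center -/

theorem IsASU.exists_truncation {b : ℤ} {g : ℤ → ℝ} (hg : IsASU b g) (h0 : ∀ x, 0 ≤ g x)
    {q : ℝ} (hq : 0 ≤ q) :
    ∃ w : ℤ → ℝ, (∀ x, 0 ≤ w x ∧ w x ≤ g x) ∧ IsASU b w ∧
      ∀ n, ∑ x ∈ block b n, w x = min q (∑ x ∈ block b n, g x) := by
  set G : ℕ → ℝ := fun n => ∑ x ∈ block b n, g x with hG
  have hsucc : ∀ n, G (n + 1) = G n + g (zig b n) := fun n => by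
    simp only [hG, sum_block, sum_range_succ]
  have hG0 : G 0 = 0 := by simp [hG, sum_block]
  -- Fill greedily outwards from `b` until mass `q` is used up; the partial sums telescope.
  refine ⟨fun x => min q (G ((zig b).symm x + 1)) - min q (G ((zig b).symm x)),
    fun x => ?_, ?_, fun n => ?_⟩
  · obtain ⟨i, rfl⟩ := (zig b).surjective x
    have := h0 (zig b i)
    simp only [Equiv.symm_apply_apply, hsucc]
    rcases min_cases q (G i) with h | h <;>
      rcases min_cases q (G i + g (zig b i)) with h' | h' <;> constructor <;> linarith
  · rw [isASU_iff_antitone] at hg ⊢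
    refine antitone_nat_of_succ_le fun i => ?_
    have h1 := hg i.le_succ
    have h2 := h0 (zig b i)
    have h3 := h0 (zig b (i + 1))
    simp only [Nat.succ_eq_add_one] at h1
    simp only [Equiv.symm_apply_apply, hsucc]
    rcases min_cases q (G i) with h | h <;>
      rcases min_cases q (G i + g (zig b i)) with h' | h' <;>
      rcases min_cases q (G i + g (zig b i) + g (zig b (i + 1))) with h'' | h'' <;> linarith
  · rw [sum_block]
    simp only [Equiv.symm_apply_apply]
    rw [sum_range_sub fun i => min q (G i), hG0, min_eq_right hq, sub_zero]

theorem exists_tsum_eq_sum_block {g : ℤ → ℝ} (hg : g.support.Finite) (b : ℤ) :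
    ∃ N, ∀ w : ℤ → ℝ, (∀ x, g x = 0 → w x = 0) → ∑' x, w x = ∑ x ∈ block b N, w x := by
  obtain ⟨N, hN⟩ := exists_forall_ge_eq_zero hg (zig b)
  exact ⟨N, fun w hw => by
    rw [sum_block]
    exact tsum_eq_sum_range _ fun i hi => hw _ (hN i hi)⟩

/-- If a part `f'` of `f` is kept, then the same amount of mass can be kept of `g ≻ f` such that
the part that is kept is a.s.u. and majorizes `f'`. -/
theorem Dominated.exists_truncation {b : ℤ} {f f' g : ℤ → ℝ} (hfg : Dominated b f g)
    (hg : IsASU b g) (h0 : ∀ x, 0 ≤ g x) (hfin : g.support.Finite) (hf : f.support.Finite)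
    (htot : ∑' x, f x = ∑' x, g x) (hf' : ∀ x, 0 ≤ f' x ∧ f' x ≤ f x) :
    ∃ w : ℤ → ℝ, (∀ x, 0 ≤ w x ∧ w x ≤ g x) ∧ IsASU b w ∧ Dominated b f' w ∧
      ∑' x, f' x = ∑' x, w x := by
  have hzero : ∀ x, f x = 0 → f' x = 0 := fun x hx => by
    have := hf' x
    linarith
  have hsf : Summable f := summable_of_hasFiniteSupport hf
  have hsf' : Summable f' := summable_of_hasFiniteSupport (hf.subset fun x hx h => hx (hzero x h))
  have hq : 0 ≤ ∑' x, f' x := tsum_nonneg fun x => (hf' x).1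
  obtain ⟨w, hw, hasu, hsum⟩ := hg.exists_truncation h0 hq
  refine ⟨w, hw, hasu, fun A => ?_, ?_⟩
  · rw [hsum]
    -- A finite sum of `f'` is bounded both by the total mass of `f'` and by the same sum of `f`.
    exact le_min (hsf'.sum_le_tsum _ fun x _ => (hf' x).1)
      ((sum_le_sum fun x _ => (hf' x).2).trans (hfg A))
  · obtain ⟨N, hN⟩ := exists_tsum_eq_sum_block hfin b
    rw [hN w fun x hx => by have := hw x; linarith, hsum, ← hN g fun x hx => hx, ← htot,
      min_eq_left (hsf'.tsum_le_tsum (fun x => (hf' x).2) hsf)]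

/-! ### Beliefs -/

variable {B : ℕ}

theorem IsBelief.nonneg {θ : Belief B} (h : IsBelief θ) (x : ℤ) (e : Fin (B + 1)) : 0 ≤ θ x e :=
  h.1 x e

theorem IsBelief.finite {θ : Belief B} (h : IsBelief θ) (e : Fin (B + 1)) :
    (Function.support fun x => θ x e).Finite :=
  h.2.1 e

theorem tsum_sum_comm {u : ℤ → Fin (B + 1) → ℝ} (h : ∀ e, (Function.support fun x => u x e).Finite) :
    ∑' x, ∑ e, u x e = ∑ e, ∑' x, u x e :=
  Summable.tsum_finsetSum fun e _ => summable_of_hasFiniteSupport (h e)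

theorem summable_sum_of_finite_support {u : ℤ → Fin (B + 1) → ℝ}
    (h : ∀ e, (Function.support fun x => u x e).Finite) : Summable fun x => ∑ e, u x e :=
  summable_sum fun e _ => summable_of_hasFiniteSupport (h e)

theorem IsBelief.exists_ne_zero {θ : Belief B} (h : IsBelief θ) : ∃ x e, θ x e ≠ 0 := by
  by_contra! hc
  have := h.2.2
  simp [hc] at this

theorem finite_support_mul {θ : Belief B} (h : ∀ e, (Function.support fun x => θ x e).Finite)
    (u : ℤ → Fin (B + 1) → ℝ) (e : Fin (B + 1)) :
    (Function.support fun x => θ x e * u x e).Finite :=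
  (h e).subset fun x hx hx' => hx (by simp [show θ x e = 0 from hx'])

theorem isBelief_pointMass (x : ℤ) (e : Fin (B + 1)) : IsBelief (pointMass x e) := by
  refine ⟨fun y e' => ?_, fun e' => ?_, ?_⟩
  · unfold pointMass
    split_ifs <;> norm_num
  · refine (Set.finite_singleton x).subset fun y hy => ?_
    by_contra h
    exact hy (if_neg fun h' => h h'.1)
  · rw [tsum_eq_single x fun y hy => sum_eq_zero fun e' _ => by simp [pointMass, hy]]
    simp [pointMass]

theorem relR_pointMass (x y : ℤ) (e : Fin (B + 1)) : RelR (pointMass x e) (pointMass y e) := by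
  have hy := isBelief_pointMass y e
  have hasu : ∀ e', IsASU y fun z => pointMass y e z e' := fun e' n => by
    simp only [pointMass]
    constructor <;> split_ifs with h1 h2 h3 <;> try norm_num
    · exact absurd ⟨by omega, h1.2⟩ h2
    · omega
  refine ⟨fun e' => Dominated.majorized (b := y) (fun A => ?_) (fun z => hy.nonneg z e')
    (hy.finite e') ?_, y, hasu⟩
  · by_cases he : e' = e
    · rcases A.eq_empty_or_nonempty with rfl | hA
      · simp [block]
      · have hmem : y ∈ block y A.card := by
          rw [mem_block]
          have := hA.card_pos
          omega
        simp only [pointMass, he, and_true, sum_ite_eq', if_pos hmem]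
        split_ifs <;> norm_num
    · simp [pointMass, he]
  · by_cases he : e' = e
    · simp [pointMass, he]
    · simp [pointMass, he]

namespace Model

variable {M : Model B} {t : ℕ}

/-- The center carries the largest mass at each level, so it lies in the support. This makes `b` an
admissible estimate. -/
theorem BeliefAt.center_mem {θ : Belief B} (h : M.BeliefAt t θ) {b : ℤ}
    (hb : ∀ e, IsASU b fun x => θ x e) : b ∈ M.states t := by
  obtain ⟨x, e, hx⟩ := h.1.exists_ne_zero
  have h1 := (hb e).le_center x
  have h2 := (h.1.nonneg x e).lt_of_ne' hx
  exact h.2 b e (h2.trans_le h1).ne'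

theorem beliefAt_pointMass {x : ℤ} (hx : x ∈ M.states t) (e : Fin (B + 1)) :
    M.BeliefAt t (pointMass x e) := by
  refine ⟨isBelief_pointMass x e, fun y e' h => ?_⟩
  unfold pointMass at h
  split_ifs at h with h'
  · rwa [h'.1]
  · exact absurd rfl h

theorem PropertyR.pointMass_eq {V : Belief B → ℝ} (hV : M.PropertyR t V) {x y : ℤ}
    (hx : x ∈ M.states t) (hy : y ∈ M.states t) (e : Fin (B + 1)) :
    V (pointMass x e) = V (pointMass y e) :=
  le_antisymm
    (hV _ _ (beliefAt_pointMass hy e) (beliefAt_pointMass hx e) (relR_pointMass y x e))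
    (hV _ _ (beliefAt_pointMass hx e) (beliefAt_pointMass hy e) (relR_pointMass x y e))

/-! ### The transmission decision -/

/-- The probability that nothing is transmitted. -/
noncomputable def silence (π : Belief B) (γ : Prescription B) : ℝ :=
  ∑' x, ∑ e, π x e * (1 - γ.1 x e)

theorem silence_nonneg {π : Belief B} (hπ : IsBelief π) (γ : Prescription B) : 0 ≤ silence π γ :=
  tsum_nonneg fun x => sum_nonneg fun e _ =>
    mul_nonneg (hπ.nonneg x e) (sub_nonneg.2 (γ.2.1 x e).2)

theorem beliefAt_Q2_none {π : Belief B} (hπ : M.BeliefAt t π) {γ : Prescription B}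
    (h : silence π γ ≠ 0) : M.BeliefAt t (Q2 π γ none) := by
  refine ⟨⟨fun x e => div_nonneg (mul_nonneg (hπ.1.nonneg x e) (sub_nonneg.2 (γ.2.1 x e).2))
    (silence_nonneg hπ.1 γ), fun e => ?_, ?_⟩, fun x e hx => hπ.2 x e fun h0 => hx ?_⟩
  · refine (hπ.1.finite e).subset fun x hx h0 => hx ?_
    simp [Q2, show π x e = 0 from h0]
  · change ∑' x, ∑ e, π x e * (1 - γ.1 x e) / silence π γ = 1
    simp only [← sum_div]
    rw [tsum_div_const]
    exact div_self h
  · simp [Q2, h0]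

theorem costW_eq (M : Model B) {V : Belief B → ℝ} {π : Belief B} (hπ : IsBelief π)
    (γ : Prescription B) {v : Fin (B + 1) → ℝ}
    (hv : ∀ x e, π x e ≠ 0 → V (pointMass x (spend e)) = v e) :
    M.costW V π γ =
      ∑ e, (∑' x, π x e - ∑' x, π x e * (1 - γ.1 x e)) * (M.c + v e) +
        (∑ e, ∑' x, π x e * (1 - γ.1 x e)) * V (Q2 π γ none) := by
  unfold costW
  rw [tsum_sum_comm (finite_support_mul hπ.2.1 _), sum_mul, ← sum_add_distrib]
  refine sum_congr rfl fun e _ => ?_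
  have s1 : Summable fun x => π x e := summable_of_hasFiniteSupport (hπ.finite e)
  have s2 : Summable fun x => π x e * (1 - γ.1 x e) :=
    summable_of_hasFiniteSupport (finite_support_mul hπ.2.1 (fun x e => 1 - γ.1 x e) e)
  rw [← s1.tsum_sub s2, ← tsum_mul_right, ← tsum_mul_right,
    ← ((s1.sub s2).mul_right _).tsum_add (s2.mul_right _)]
  refine tsum_congr fun x => ?_
  by_cases hx : π x e = 0
  · simp [hx]
  · simp only [Q2, hv x e hx]
    ring

/-- Lower bounds are carried along because an infimum of reals can only be compared with its members
when the family is bounded below. The term `|M.c|` allows for a negative transmission cost. -/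
theorem le_costW {V : Belief B → ℝ} {L : ℝ} (hL : ∀ θ, M.BeliefAt t θ → L ≤ V θ) {π : Belief B}
    (hπ : M.BeliefAt t π) (γ : Prescription B) : L - |M.c| ≤ M.costW V π γ := by
  have h1 : ∑' x, ∑ e, π x e * (L - |M.c|) = L - |M.c| := by
    simp only [← sum_mul]
    rw [tsum_mul_right, hπ.1.2.2, one_mul]
  unfold costW
  refine h1.symm.trans_le (Summable.tsum_le_tsum (fun x => sum_le_sum fun e _ => ?_)
    (summable_sum_of_finite_support (finite_support_mul hπ.1.2.1 _))
    (summable_sum_of_finite_support (finite_support_mul hπ.1.2.1 _)))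
  have hc := neg_abs_le M.c
  have hc' := abs_nonneg M.c
  have hγ := γ.2.1 x e
  have hp := hπ.1.nonneg x e
  by_cases hx : π x e = 0
  · simp [hx]
  have h2 := hL _ (beliefAt_pointMass (hπ.2 x e hx) (spend e))
  have h3 : π x e * γ.1 x e * (L - |M.c|) ≤
      π x e * γ.1 x e * (M.c + V (Q2 π γ (some (x, e)))) :=
    mul_le_mul_of_nonneg_left (by simp only [Q2]; linarith) (mul_nonneg hp hγ.1)
  have h4 : π x e * (1 - γ.1 x e) * (L - |M.c|) ≤ π x e * (1 - γ.1 x e) * V (Q2 π γ none) := by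
    -- If silence has probability zero, `Q2 π γ none` is `0 / 0 = 0`, which is not a belief, but its
    -- weight is zero too.
    by_cases hs : silence π γ = 0
    · have h5 : π x e * (1 - γ.1 x e) = 0 := by
        have hn : ∀ x e, 0 ≤ π x e * (1 - γ.1 x e) := fun x e =>
          mul_nonneg (hπ.1.nonneg x e) (sub_nonneg.2 (γ.2.1 x e).2)
        refine le_antisymm ?_ (hn x e)
        calc π x e * (1 - γ.1 x e) ≤ ∑ e, π x e * (1 - γ.1 x e) :=
              single_le_sum (f := fun e => π x e * (1 - γ.1 x e)) (fun e _ => hn x e) (mem_univ e)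
          _ ≤ silence π γ := (summable_sum_of_finite_support (finite_support_mul hπ.1.2.1 _)).le_tsum x
              fun y _ => sum_nonneg fun e _ => hn y e
          _ = 0 := hs
      simp [h5]
    · have h5 := hL _ (beliefAt_Q2_none hπ hs)
      exact mul_le_mul_of_nonneg_left (by linarith) (mul_nonneg hp (by linarith [hγ.2]))
  linarith

instance : Nonempty (Prescription B) := ⟨⟨fun _ _ => 0, by simp, by simp⟩⟩

theorem le_stepW {V : Belief B → ℝ} {L : ℝ} (hL : ∀ θ, M.BeliefAt t θ → L ≤ V θ) {π : Belief B}
    (hπ : M.BeliefAt t π) : L - |M.c| ≤ M.stepW V π :=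
  le_ciInf fun γ => le_costW hL hπ γ

/-- The prescription that transmits in the states far from `b`, matched to a given one. -/
theorem exists_matching_prescription {π π' : Belief B} (hπ : IsBelief π) (hπ' : IsBelief π')
    {b : ℤ} (hmaj : ∀ e, Majorized (fun x => π x e) fun x => π' x e)
    (hb : ∀ e, IsASU b fun x => π' x e) (γ : Prescription B) :
    ∃ γ' : Prescription B, ∀ e, IsASU b (fun x => π' x e * (1 - γ'.1 x e)) ∧
      Dominated b (fun x => π x e * (1 - γ.1 x e)) (fun x => π' x e * (1 - γ'.1 x e)) ∧
      ∑' x, π x e * (1 - γ.1 x e) = ∑' x, π' x e * (1 - γ'.1 x e) := by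
  have key := fun e => ((hmaj e).dominated (fun x => hπ.nonneg x e) (hπ.finite e)
    (hb e)).exists_truncation (f' := fun x => π x e * (1 - γ.1 x e)) (hb e)
    (fun x => hπ'.nonneg x e) (hπ'.finite e) (hπ.finite e) (hmaj e).2 fun x =>
      ⟨mul_nonneg (hπ.nonneg x e) (sub_nonneg.2 (γ.2.1 x e).2),
        mul_le_of_le_one_right (hπ.nonneg x e) (by linarith [(γ.2.1 x e).1])⟩
  choose w hw hasu hdom htot using key
  -- Without energy everything is silent under `γ`, so the truncation at level 0 must keep all the
  -- mass; this makes `γ'` admissible.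
  have hw0 : ∀ x, w 0 x = π' x 0 := by
    obtain ⟨N, hN⟩ := exists_tsum_eq_sum_block (hπ'.finite 0) b
    have hzero : ∀ x, π' x 0 = 0 → w 0 x = 0 := fun x hx => by
      have := hw 0 x
      linarith
    have sw : Summable (w 0) :=
      summable_of_hasFiniteSupport ((hπ'.finite 0).subset fun x hx h => hx (hzero x h))
    have sp : Summable fun x => π' x 0 := summable_of_hasFiniteSupport (hπ'.finite 0)
    have h1 : ∑' x, (π' x 0 - w 0 x) = 0 := by
      rw [sp.tsum_sub sw, ← htot 0, ← (hmaj 0).2]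
      simp [γ.2.2]
    have h2 := (sp.sub sw).hasSum
    rw [h1, hasSum_zero_iff_of_nonneg fun x => sub_nonneg.2 (hw 0 x).2] at h2
    exact fun x => (sub_eq_zero.1 (congrFun h2 x)).symm
  have hle : ∀ x e, w e x / π' x e ≤ 1 := fun x e =>
    div_le_one_of_le₀ (hw e x).2 (hπ'.nonneg x e)
  have hnn : ∀ x e, 0 ≤ w e x / π' x e := fun x e => div_nonneg (hw e x).1 (hπ'.nonneg x e)
  -- The silent part of `π'` becomes `w`. Where `π'` vanishes the formula would give `1 - 0 / 0 =
  -- 1`, which is forbidden at level 0.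
  let γ' : Prescription B := ⟨fun x e => if π' x e = 0 then 0 else 1 - w e x / π' x e,
    fun x e => by
      have := hle x e
      have := hnn x e
      dsimp only
      split_ifs <;> constructor <;> linarith,
    fun x => by
      dsimp only
      split_ifs with h
      · rfl
      · rw [hw0, div_self h, sub_self]⟩
  have hγ' : ∀ e, (fun x => π' x e * (1 - γ'.1 x e)) = w e := fun e => funext fun x => by
    by_cases h : π' x e = 0
    · have := hw e x
      simp only [h, zero_mul]
      linarith
    · simp only [γ', if_neg h, sub_sub_cancel]
      exact mul_div_cancel₀ _ h
  refine ⟨γ', fun e => ?_⟩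
  rw [hγ' e]
  exact ⟨hasu e, hdom e, htot e⟩

theorem propertyR_stepW {V : Belief B → ℝ} (hV : M.PropertyR t V) {L : ℝ}
    (hL : ∀ θ, M.BeliefAt t θ → L ≤ V θ) : M.PropertyR t (M.stepW V) := by
  intro π π' hπ hπ' hR
  obtain ⟨hmaj, b, hb⟩ := hR
  refine le_ciInf fun γ => ?_
  obtain ⟨γ', hγ'⟩ := exists_matching_prescription hπ.1 hπ'.1 hmaj hb γ
  refine (ciInf_le ⟨L - |M.c|, ?_⟩ γ').trans ?_
  · rintro _ ⟨γ₁, rfl⟩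
    exact le_costW hL hπ' γ₁
  have hbs := hπ'.center_mem hb
  have hv : ∀ {π : Belief B}, M.BeliefAt t π → ∀ x e, π x e ≠ 0 →
      V (pointMass x (spend e)) = V (pointMass b (spend e)) := fun h x e hx =>
    hV.pointMass_eq (h.2 x e hx) hbs _
  rw [M.costW_eq hπ.1 γ (hv hπ), M.costW_eq hπ'.1 γ' (hv hπ')]
  have hq : ∀ e, ∑' x, π x e * (1 - γ.1 x e) = ∑' x, π' x e * (1 - γ'.1 x e) := fun e => (hγ' e).2.2
  have hm : ∀ e, ∑' x, π x e = ∑' x, π' x e := fun e => (hmaj e).2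
  simp only [hq, hm]
  have hs' : silence π' γ' = ∑ e, ∑' x, π' x e * (1 - γ'.1 x e) :=
    tsum_sum_comm (finite_support_mul hπ'.1.2.1 _)
  have hs : silence π γ = silence π' γ' := by
    rw [hs', silence, tsum_sum_comm (finite_support_mul hπ.1.2.1 _)]
    exact sum_congr rfl fun e _ => hq e
  rw [← hs']
  refine add_le_add_right ?_ _
  -- The transmission terms have cancelled and the normalizing constants agree; only the silent
  -- beliefs remain to be compared.
  by_cases h0 : silence π' γ' = 0
  · simp [h0]
  have hpos := silence_nonneg hπ'.1 γ'
  refine mul_le_mul_of_nonneg_left (hV _ _ (beliefAt_Q2_none hπ (hs ▸ h0))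
    (beliefAt_Q2_none hπ' h0) ⟨fun e => ?_, b, fun e n => ?_⟩) hpos
  · have hB := (beliefAt_Q2_none hπ' h0).1
    refine Dominated.majorized (b := b) (fun A => ?_) (fun x => hB.nonneg x e) (hB.finite e) ?_
    · change ∑ x ∈ A, π x e * (1 - γ.1 x e) / silence π γ ≤
        ∑ x ∈ block b A.card, π' x e * (1 - γ'.1 x e) / silence π' γ'
      rw [← sum_div, ← sum_div, hs]
      exact div_le_div_of_nonneg_right ((hγ' e).2.1 A) hpos
    · change ∑' x, π x e * (1 - γ.1 x e) / silence π γ =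
        ∑' x, π' x e * (1 - γ'.1 x e) / silence π' γ'
      rw [tsum_div_const, tsum_div_const, hs, hq]
  · exact ⟨div_le_div_of_nonneg_right ((hγ' e).1 n).1 hpos,
      div_le_div_of_nonneg_right ((hγ' e).1 n).2 hpos⟩

end Model

/-! ### The evolution of the source and the estimation -/

theorem finite_support_conv {μ f : ℤ → ℝ} (hμ : μ.support.Finite) (hf : f.support.Finite) :
    (Function.support fun x => ∑' y, μ (x - y) * f y).Finite := by
  refine (hμ.add hf).subset fun x hx => ?_
  by_contra h
  refine hx ((tsum_congr fun y => ?_).trans tsum_zero)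
  by_contra hy
  exact h ⟨x - y, left_ne_zero_of_mul hy, y, right_ne_zero_of_mul hy, by simp⟩

theorem tsum_conv {μ f : ℤ → ℝ} (hμ : IsFinDist μ) (hf : f.support.Finite) :
    ∑' x, ∑' y, μ (x - y) * f y = ∑' y, f y := by
  have h1 : ∀ u : ℤ → ℝ, ∑' y, u y * f y = ∑ y ∈ hf.toFinset, u y * f y := fun u =>
    tsum_eq_sum fun y hy => by
      have : f y = 0 := by simpa using hy
      rw [this, mul_zero]
  have hs : Summable μ := summable_of_hasFiniteSupport hμ.2.1
  have h2 : ∀ y, ∑' x, μ (x - y) * f y = f y := fun y => by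
    have := (Equiv.subRight y).tsum_eq μ
    simp only [Equiv.subRight_apply] at this
    rw [tsum_mul_right, this, hμ.2.2, one_mul]
  have h3 := h1 fun _ => 1
  simp only [one_mul] at h3
  simp only [h1]
  rw [Summable.tsum_finsetSum fun y _ => ?_, h3]
  · exact sum_congr rfl fun y _ => h2 y
  · exact ((Equiv.subRight y).summable_iff.2 hs).mul_right _

namespace Model

variable {M : Model B} {t : ℕ}

theorem Q1_eq (M : Model B) {θ : Belief B} (hθ : ∀ e, (Function.support fun x => θ x e).Finite)
    (x : ℤ) (e : Fin (B + 1)) :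
    M.Q1 t θ x e = ∑ e', (M.energy t e' e).toReal * ∑' y, M.noise t (x - y) * θ y e' := by
  unfold Q1
  have := tsum_sum_comm (finite_support_mul hθ fun y e' =>
    M.noise t (x - y) * (M.energy t e' e).toReal)
  simp only [mul_comm (θ _ _)] at this
  rw [this]
  refine sum_congr rfl fun e' _ => ?_
  rw [← tsum_mul_left]
  exact tsum_congr fun y => by ring

theorem sum_energy (M : Model B) (e' : Fin (B + 1)) : ∑ e, (M.energy t e' e).toReal = 1 := by
  have := (M.energy t e').tsum_coe
  rw [tsum_fintype] at this
  rw [← ENNReal.toReal_sum fun e _ => PMF.apply_ne_top _ _, this, ENNReal.toReal_one]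

/-- `Reach` grows at its end, whereas the passage from `states t` to `states (t + 1)` requires a
transition prepended. -/
theorem Reach.head {x z y : ℤ} {s : ℕ} (hz : 0 < M.noise t z) (h : M.Reach (t + 1) (x + z) s y) :
    M.Reach t x s y := by
  induction h with
  | refl => exact .step .refl hz
  | step _ h ih => exact .step ih h

theorem finite_support_Q1 (hnoise : IsFinDist (M.noise t)) {θ : Belief B}
    (hθ : ∀ e, (Function.support fun x => θ x e).Finite) (e : Fin (B + 1)) :
    (Function.support fun x => M.Q1 t θ x e).Finite := by
  refine (Set.finite_iUnion fun e' => finite_support_conv hnoise.2.1 (hθ e')).subset fun x hx => ?_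
  rw [Function.mem_support, M.Q1_eq hθ] at hx
  obtain ⟨e', -, h⟩ := exists_ne_zero_of_sum_ne_zero hx
  exact Set.mem_iUnion.2 ⟨e', right_ne_zero_of_mul h⟩

theorem tsum_Q1 (hnoise : IsFinDist (M.noise t)) {θ : Belief B}
    (hθ : ∀ e, (Function.support fun x => θ x e).Finite) (e : Fin (B + 1)) :
    ∑' x, M.Q1 t θ x e = ∑ e', (M.energy t e' e).toReal * ∑' x, θ x e' := by
  simp only [M.Q1_eq hθ]
  rw [Summable.tsum_finsetSum fun e' _ => (summable_of_hasFiniteSupport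
    (finite_support_conv hnoise.2.1 (hθ e'))).mul_left _]
  exact sum_congr rfl fun e' _ => by rw [tsum_mul_left, tsum_conv hnoise (hθ e')]

theorem BeliefAt.Q1 (hnoise : IsFinDist (M.noise t)) {θ : Belief B} (hθ : M.BeliefAt t θ) :
    M.BeliefAt (t + 1) (M.Q1 t θ) := by
  refine ⟨⟨fun x e => ?_, finite_support_Q1 hnoise hθ.1.2.1, ?_⟩, fun x e hx s hs y hy => ?_⟩
  · exact tsum_nonneg fun y => sum_nonneg fun e' _ =>
      mul_nonneg (mul_nonneg (hnoise.1 _) ENNReal.toReal_nonneg) (hθ.1.nonneg y e')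
  · rw [tsum_sum_comm (finite_support_Q1 hnoise hθ.1.2.1)]
    simp only [tsum_Q1 hnoise hθ.1.2.1]
    rw [sum_comm]
    simp only [← sum_mul, sum_energy, one_mul]
    rw [← tsum_sum_comm hθ.1.2.1, hθ.1.2.2]
  · rw [M.Q1_eq hθ.1.2.1] at hx
    obtain ⟨e', -, h⟩ := exists_ne_zero_of_sum_ne_zero hx
    have h' := right_ne_zero_of_mul h
    obtain ⟨z, hz⟩ : ∃ z, M.noise t (x - z) * θ z e' ≠ 0 := by
      by_contra! hc
      exact h' (by simp [hc])
    refine hθ.2 z e' (right_ne_zero_of_mul hz) s hs y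
      (Reach.head ((hnoise.1 _).lt_of_ne' (left_ne_zero_of_mul hz)) ?_)
    rwa [add_sub_cancel]

theorem relR_Q1 (hnoise : IsFinDist (M.noise t)) (hasu : IsASU 0 (M.noise t))
    (heven : ∀ z, M.noise t (-z) = M.noise t z) {θ θ' : Belief B} (hθ : M.BeliefAt t θ)
    (hθ' : M.BeliefAt t θ') (hR : RelR θ θ') : RelR (M.Q1 t θ) (M.Q1 t θ') := by
  obtain ⟨hmaj, b, hb⟩ := hR
  have hB := (hθ'.Q1 hnoise).1
  refine ⟨fun e => Dominated.majorized (b := b) (fun A => ?_) (fun x => hB.nonneg x e)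
    (hB.finite e) ?_, b, fun e n => ?_⟩
  · simp only [M.Q1_eq hθ.1.2.1, M.Q1_eq hθ'.1.2.1]
    rw [sum_comm, sum_comm (s := block b A.card)]
    refine sum_le_sum fun e' _ => ?_
    rw [← mul_sum, ← mul_sum]
    exact mul_le_mul_of_nonneg_left (Dominated.conv hasu heven
      ((hmaj e').dominated (fun x => hθ.1.nonneg x e') (hθ.1.finite e') (hb e'))
      (fun x => hθ.1.nonneg x e') (hθ.1.finite e') (hθ'.1.finite e') (hmaj e').2 A)
      ENNReal.toReal_nonneg
  · rw [tsum_Q1 hnoise hθ.1.2.1, tsum_Q1 hnoise hθ'.1.2.1]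
    exact sum_congr rfl fun e' _ => by rw [(hmaj e').2]
  · have h := fun e' => hasu.conv heven (hθ'.1.finite e') (hb e') n
    simp only [M.Q1_eq hθ'.1.2.1]
    exact ⟨sum_le_sum fun e' _ => mul_le_mul_of_nonneg_left (h e').1 ENNReal.toReal_nonneg,
      sum_le_sum fun e' _ => mul_le_mul_of_nonneg_left (h e').2 ENNReal.toReal_nonneg⟩

theorem states_subset (ht : t ≤ M.T) : M.states t ⊆ M.X := fun x hx => hx t ht x .refl

section Distortion

variable {d : ℕ → ℝ}

/-- The formula for `ρ` is known only on `M.X`, which contains the support of the belief. -/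
theorem tsum_distortion_eq (hρ : ∀ x ∈ M.X, ∀ a ∈ M.X, M.ρ x a = d (x - a).natAbs) (ht : t ≤ M.T)
    {θ : Belief B} (hθ : M.BeliefAt t θ) {a : ℤ} (ha : a ∈ M.X) :
    ∑' x, ∑ e, M.ρ x a * θ x e = ∑ e, ∑' x, θ x e * d (x - a).natAbs := by
  rw [← tsum_sum_comm (finite_support_mul hθ.1.2.1 fun x _ => d (x - a).natAbs)]
  refine tsum_congr fun x => sum_congr rfl fun e _ => ?_
  by_cases hx : θ x e = 0
  · simp [hx]
  · rw [hρ x (states_subset ht (hθ.2 x e hx)) a ha, mul_comm]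

theorem le_tsum_distortion (hd : Monotone d)
    (hρ : ∀ x ∈ M.X, ∀ a ∈ M.X, M.ρ x a = d (x - a).natAbs) (ht : t ≤ M.T)
    {θ : Belief B} (hθ : M.BeliefAt t θ) {a : ℤ} (ha : a ∈ M.X) :
    d 0 ≤ ∑' x, ∑ e, M.ρ x a * θ x e := by
  have h1 : ∑' x, ∑ e, θ x e * d 0 = d 0 := by
    simp only [← sum_mul]
    rw [tsum_mul_right, hθ.1.2.2, one_mul]
  rw [tsum_distortion_eq hρ ht hθ ha, ← h1, tsum_sum_comm (finite_support_mul hθ.1.2.1 _)]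
  refine sum_le_sum fun e _ => Summable.tsum_le_tsum
    (fun x => mul_le_mul_of_nonneg_left (hd (Nat.zero_le _)) (hθ.1.nonneg x e))
    (summable_of_hasFiniteSupport (finite_support_mul hθ.1.2.1 (fun _ _ => d 0) e))
    (summable_of_hasFiniteSupport (finite_support_mul hθ.1.2.1 (fun x _ => d (x - a).natAbs) e))

theorem BeliefAt.nonempty (ht : t ≤ M.T) {θ : Belief B} (hθ : M.BeliefAt t θ) : Nonempty M.X := by
  obtain ⟨x, e, hx⟩ := hθ.1.exists_ne_zero
  exact ⟨⟨x, states_subset ht (hθ.2 x e hx)⟩⟩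

theorem isASU_neg_distortion (hd : Monotone d) (a : ℤ) : IsASU a fun x => -d (x - a).natAbs :=
  fun n => ⟨neg_le_neg (hd (by omega)), neg_le_neg (hd (by omega))⟩

/-- Translation by `b - a` turns distances to `a` into distances to `b`. -/
theorem dominated_neg_distortion (hd : Monotone d) (a b : ℤ) :
    Dominated b (fun x => -d (x - a).natAbs) fun x => -d (x - b).natAbs := by
  intro A
  have h := (isASU_neg_distortion hd b).sum_le_sum_block (A.map (Equiv.addRight (b - a)).toEmbedding)
  rw [sum_map, card_map] at h
  convert h using 5
  simp only [Equiv.coe_toEmbedding, Equiv.coe_addRight]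
  ring

theorem propertyR_stepV (hnoise : IsFinDist (M.noise t)) (hasu : IsASU 0 (M.noise t))
    (heven : ∀ z, M.noise t (-z) = M.noise t z) (hd : Monotone d)
    (hρ : ∀ x ∈ M.X, ∀ a ∈ M.X, M.ρ x a = d (x - a).natAbs) (ht : t ≤ M.T)
    {W : Belief B → ℝ} (hW : M.PropertyR (t + 1) W) : M.PropertyR t (M.stepV t W) := by
  intro θ θ' hθ hθ' hR
  refine add_le_add (hW _ _ (hθ.Q1 hnoise) (hθ'.Q1 hnoise)
    (relR_Q1 hnoise hasu heven hθ hθ' hR)) ?_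
  obtain ⟨hmaj, b, hb⟩ := hR
  have hbX := states_subset ht (hθ'.center_mem hb)
  have := hθ.nonempty ht
  refine le_ciInf fun a => (ciInf_le ⟨d 0, ?_⟩ (⟨b, hbX⟩ : M.X)).trans ?_
  · rintro _ ⟨a', rfl⟩
    exact le_tsum_distortion hd hρ ht hθ' a'.2
  rw [tsum_distortion_eq hρ ht hθ' hbX, tsum_distortion_eq hρ ht hθ a.2]
  refine sum_le_sum fun e _ => ?_
  have := ((hmaj e).dominated (fun x => hθ.1.nonneg x e) (hθ.1.finite e) (hb e)).tsum_mul_le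
    (fun x => hθ.1.nonneg x e) (hθ.1.finite e) (hθ'.1.finite e) (hmaj e).2
    (dominated_neg_distortion hd a b) (isASU_neg_distortion hd b)
  simp only [mul_neg, tsum_neg] at this
  linarith

theorem le_stepV (hnoise : IsFinDist (M.noise t)) (hd : Monotone d)
    (hρ : ∀ x ∈ M.X, ∀ a ∈ M.X, M.ρ x a = d (x - a).natAbs) (ht : t ≤ M.T)
    {W : Belief B → ℝ} {L : ℝ} (hL : ∀ π, M.BeliefAt (t + 1) π → L ≤ W π) {θ : Belief B}
    (hθ : M.BeliefAt t θ) : L + d 0 ≤ M.stepV t W θ := by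
  have := hθ.nonempty ht
  exact add_le_add (hL _ (hθ.Q1 hnoise))
    (le_ciInf fun a => le_tsum_distortion hd hρ ht hθ a.2)

theorem propertyR_valueW (hnoise : ∀ t, IsFinDist (M.noise t)) (hasu : ∀ t, IsASU 0 (M.noise t))
    (heven : ∀ t z, M.noise t (-z) = M.noise t z) (hd : Monotone d)
    (hρ : ∀ x ∈ M.X, ∀ a ∈ M.X, M.ρ x a = d (x - a).natAbs) :
    ∀ {k t : ℕ}, t + k = M.T + 1 →
      M.PropertyR t (M.valueW k) ∧ ∃ L, ∀ π, M.BeliefAt t π → L ≤ M.valueW k π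
  | 0, t, _ => ⟨fun _ _ _ _ _ => le_rfl, 0, fun _ _ => le_rfl⟩
  | k + 1, t, ht => by
    obtain ⟨h, L, hL⟩ := propertyR_valueW hnoise hasu heven hd hρ (k := k) (t := t + 1) (by omega)
    have e : M.T - k = t := by omega
    have hL' := fun θ hθ => le_stepV (hnoise t) hd hρ (by omega) hL (θ := θ) hθ
    simp only [valueW, e]
    exact ⟨propertyR_stepW (propertyR_stepV (hnoise t) (hasu t) (heven t) hd hρ (by omega) h) hL',
      _, fun π hπ => le_stepW hL' hπ⟩

end Distortion

end Model

end RemoteEstimation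

theorem claim1 {B : ℕ} (M : RemoteEstimation.Model B)
    (hnoise : ∀ t, RemoteEstimation.IsFinDist (M.noise t))
    (hasu : ∀ t, RemoteEstimation.IsASU 0 (M.noise t))
    (heven : ∀ t z, M.noise t (-z) = M.noise t z)
    (d : ℕ → ℝ) (hd : Monotone d)
    (hρ : ∀ x ∈ M.X, ∀ a ∈ M.X, M.ρ x a = d (x - a).natAbs) :
    (∀ t ∈ Set.Icc 1 M.T, M.PropertyR t (M.V t)) ∧
      ∀ t ∈ Set.Icc 1 (M.T + 1), M.PropertyR t (M.W t) := by
  have hW : ∀ t ≤ M.T + 1, M.PropertyR t (M.W t) := fun t ht =>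
    (RemoteEstimation.Model.propertyR_valueW hnoise hasu heven hd hρ (by omega)).1
  exact ⟨fun t ht => RemoteEstimation.Model.propertyR_stepV (hnoise t) (hasu t) (heven t) hd hρ
    ht.2 (hW (t + 1) (by have := ht.2; omega)), fun t ht => hW t ht.2⟩
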